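/- Let $X$ be a complex Banach space and $T$ a bounded linear operator on $X$. Write $N(\cdot)$ and $R(\cdot)$ for kernel and range, $\sigma(T)$ for the spectrum of $T$, $\sigma_a(T)$ for the approximate point spectrum (the set of $\lambda\in\mathbb{C}$ such that $T-\lambda I$ is not bounded below), and $\operatorname{iso} A$ for the set of isolated points of $A\subset\mathbb{C}$. A bounded operator $S$ on a normed space is upper semi-Fredholm if $R(S)$ is closed and $\dim N(S)<\infty$. A bounded operator $S$ on $X$ is upper semi-B-Fredholm if for some integer $n\ge 0$ the range $R(S^n)$ is closed and the restriction $S_{[n]}:R(S^n)\to R(S^n)$ of $S$ is upper semi-Fredholm. It is left Drazin invertible if its ascent $p=\min\{n\ge 0: N(S^n)=N(S^{n+1})\}$ is finite and $R(S^{p+1})$ is closed. Let $\sigma_{uf}(T)$, $\sigma_{ubf}(T)$ and $\sigma_{ld}(T)$ be the sets of $\lambda\in\mathbb{C}$ such that $T-\lambda I$ is, respectively, not upper semi-Fredholm, not upper semi-B-Fredholm, and not left Drazin invertible. Put $$\pi_0(T)=\{\lambda\in\operatorname{iso}\sigma(T): \dim N(T-\lambda I)>0\},\qquad \pi_{00}(T)=\{\lambda\in\operatorname{iso}\sigma(T):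 0<\dim N(T-\lambda I)<\infty\},$$ and let $p_0^a(T)=\sigma_a(T)\setminus\sigma_{ld}(T)$ be the set of left poles of $T$. The operator $T$ satisfies property $(w_{\pi_{00}})$ if $\sigma_a(T)\setminus\sigma_{uf}(T)=\pi_{00}(T)$, and property $(gw_{\pi_{00}})$ if $\sigma_a(T)\setminus\sigma_{ubf}(T)=\pi_0(T)$. Then the following statements are equivalent: (i) $T$ satisfies property $(gw_{\pi_{00}})$; (ii) $T$ satisfies property $(w_{\pi_{00}})$ and $\pi_0(T)=p_0^a(T)$. -/

import Mathlib

namespace WeylType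

/-- The isolated points of a set `S` of complex numbers. -/
def iso (S : Set ℂ) : Set ℂ := {z | z ∈ S ∧ ¬ AccPt z (Filter.principal S)}

section Operators

variable {X : Type*} [NormedAddCommGroup X] [NormedSpace ℂ X]

/-- The operator `T - z I`. -/
def shift (T : X →L[ℂ] X) (z : ℂ) : X →L[ℂ] X := T - z • ContinuousLinearMap.id ℂ X

/-- `T` is bounded below: `c ‖x‖ ≤ ‖T x‖` for some `c > 0`. -/
def IsBoundedBelow (T : X →L[ℂ] X) : Prop := ∃ c : ℝ, 0 < c ∧ ∀ x : X, c * ‖x‖ ≤ ‖T x‖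

/-- The approximate point spectrum `σ_a(T)`. -/
def approxPointSpectrum (T : X →L[ℂ] X) : Set ℂ := {z | ¬ IsBoundedBelow (shift T z)}

/-- The set `σ_p(T)` of eigenvalues. -/
def pointSpectrum (T : X →L[ℂ] X) : Set ℂ :=
  {z | Module.End.HasEigenvalue (T : Module.End ℂ X) z}

/-- The set `σ_p^f(T)` of eigenvalues whose eigenspace is finite-dimensional. -/
def finitePointSpectrum (T : X →L[ℂ] X) : Set ℂ :=
  {z | z ∈ pointSpectrum T ∧
    FiniteDimensional ℂ (Module.End.eigenspace (T : Module.End ℂ X) z)}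

/-- `π₀(T) = iso σ(T) ∩ σ_p(T)`. -/
def pi0 (T : X →L[ℂ] X) : Set ℂ := iso (spectrum ℂ T) ∩ pointSpectrum T

/-- `π₀₀(T) = iso σ(T) ∩ σ_p^f(T)`. -/
def pi00 (T : X →L[ℂ] X) : Set ℂ := iso (spectrum ℂ T) ∩ finitePointSpectrum T

/-- Upper semi-Fredholm: finite-dimensional kernel and closed range. -/
def IsUpperSemiFredholm (T : X →L[ℂ] X) : Prop :=
  FiniteDimensional ℂ (LinearMap.ker (T : X →ₗ[ℂ] X)) ∧
    IsClosed (LinearMap.range (T : X →ₗ[ℂ] X) : Set X)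

/-- The range `R(T^n)`, a (possibly non-closed) subspace of `X`. -/
def powRange (T : X →L[ℂ] X) (n : ℕ) : Submodule ℂ X :=
  LinearMap.range ((T ^ n : X →L[ℂ] X) : X →ₗ[ℂ] X)

theorem map_mem_powRange (T : X →L[ℂ] X) (n : ℕ) {x : X} (hx : x ∈ powRange T n) :
    T x ∈ powRange T n := by
  obtain ⟨y, rfl⟩ := hx
  refine ⟨T y, ?_⟩
  change (T ^ n * T) y = (T * T ^ n) y
  rw [← pow_succ, ← pow_succ']

/-- The restriction `T_[n] : R(T^n) → R(T^n)` of `T`. -/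
def powRestrict (T : X →L[ℂ] X) (n : ℕ) : powRange T n →L[ℂ] powRange T n :=
  T.restrict fun _ hx => map_mem_powRange T n hx

/-- Upper semi-B-Fredholm: for some `n`, the range `R(T^n)` is closed and `T_[n]` is upper
semi-Fredholm. -/
def IsUpperSemiBFredholm (T : X →L[ℂ] X) : Prop :=
  ∃ n : ℕ, IsClosed (powRange T n : Set X) ∧ IsUpperSemiFredholm (powRestrict T n)

/-- The upper semi-Fredholm spectrum `σ_uf(T)`. -/
def upperSemiFredholmSpectrum (T : X →L[ℂ] X) : Set ℂ :=
  {z | ¬ IsUpperSemiFredholm (shift T z)}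

/-- The upper semi-B-Fredholm spectrum `σ_ubf(T)`. -/
def upperSemiBFredholmSpectrum (T : X →L[ℂ] X) : Set ℂ :=
  {z | ¬ IsUpperSemiBFredholm (shift T z)}

/-- The ascent of `T` is finite and equal to `p`: `p` is the least `n` with
`N(T^n) = N(T^(n+1))`. -/
def HasAscent (T : X →L[ℂ] X) (p : ℕ) : Prop :=
  IsLeast {n : ℕ | LinearMap.ker ((T ^ n : X →L[ℂ] X) : X →ₗ[ℂ] X) =
    LinearMap.ker ((T ^ (n + 1) : X →L[ℂ] X) : X →ₗ[ℂ] X)} p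

/-- Left Drazin invertible: the ascent `p` is finite and `R(T^(p+1))` is closed. -/
def IsLeftDrazinInvertible (T : X →L[ℂ] X) : Prop :=
  ∃ p : ℕ, HasAscent T p ∧ IsClosed (powRange T (p + 1) : Set X)

/-- The left Drazin spectrum `σ_ld(T)`. -/
def leftDrazinSpectrum (T : X →L[ℂ] X) : Set ℂ :=
  {z | ¬ IsLeftDrazinInvertible (shift T z)}

/-- The set `p₀^a(T) = σ_a(T) \ σ_ld(T)` of left poles of `T`. -/
def leftPoles (T : X →L[ℂ] X) : Set ℂ := approxPointSpectrum T \ leftDrazinSpectrum T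

/-- `Δ_uf(T) = σ_a(T) \ σ_uf(T)`. -/
def deltaUf (T : X →L[ℂ] X) : Set ℂ := approxPointSpectrum T \ upperSemiFredholmSpectrum T

/-- `Δ_uf^g(T) = σ_a(T) \ σ_ubf(T)`. -/
def deltaUfG (T : X →L[ℂ] X) : Set ℂ := approxPointSpectrum T \ upperSemiBFredholmSpectrum T

/-- Property `(w_{π₀₀})`. -/
def PropertyWPi00 (T : X →L[ℂ] X) : Prop := deltaUf T = pi00 T

/-- Property `(gw_{π₀₀})`. -/
def PropertyGWPi00 (T : X →L[ℂ] X) : Prop := deltaUfG T = pi0 T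

end Operators

end WeylType

namespace WeylType

/-! ### Closed range criteria. -/

section ClosedRange

variable {𝕜 E F : Type*} [NontriviallyNormedField 𝕜]
  [NormedAddCommGroup E] [NormedSpace 𝕜 E] [CompleteSpace E]
  [NormedAddCommGroup F] [NormedSpace 𝕜 F] [CompleteSpace F]

/-! Write `S` for `T - z I`. With `N(S)` finite-dimensional, semi-B-Fredholm implies semi-Fredholm,
so intersecting `Δ_uf^g = π₀` with the finite-kernel condition gives `Δ_uf = π₀₀`. Left poles always
lie in `Δ_uf^g`.

The crux is a dichotomy (`IsUpperSemiBFredholm.exists_isLeftDrazinInvertible`): a semi-B-Fredholm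
`S` is left Drazin invertible, or all its small shifts have nonzero kernel. Isolated points of the
spectrum have injective shifts nearby, so there `Δ_uf^g` consists of left poles; this gives (i) ⇒
(ii).

For (ii) ⇒ (i), small nonzero shifts of `S` are semi-Fredholm. One that is not injective gives a
point of `Δ_uf = π₀₀`, isolated in the spectrum, so some injective shift is still close to `S`, and
`z` is a left pole. -/

theorem isClosed_inter_range_of_preimage (A : E →L[𝕜] F)
    (hA : IsClosed (LinearMap.range (A : E →ₗ[𝕜] F) : Set F)) {C : Set F}
    (hC : IsClosed (A ⁻¹' C)) : IsClosed (C ∩ (LinearMap.range (A : E →ₗ[𝕜] F) : Set F)) := by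
  have : CompleteSpace (LinearMap.range (A : E →ₗ[𝕜] F)) := hA.completeSpace_coe
  let B : E →L[𝕜] LinearMap.range (A : E →ₗ[𝕜] F) :=
    A.codRestrict _ fun x => LinearMap.mem_range_self (A : E →ₗ[𝕜] F) x
  have hB : Function.Surjective B := by
    rintro ⟨_, x, rfl⟩
    exact ⟨x, rfl⟩
  -- By the open mapping theorem `A` is a quotient map onto its closed range.
  have h : IsClosed ((↑) ⁻¹' C : Set (LinearMap.range (A : E →ₗ[𝕜] F))) :=
    (B.isQuotientMap hB).isClosed_preimage.mp hC
  have h' := hA.isClosedEmbedding_subtypeVal.isClosedMap _ h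
  have h'' : Subtype.val '' ((↑) ⁻¹' C : Set (LinearMap.range (A : E →ₗ[𝕜] F))) =
      C ∩ (LinearMap.range (A : E →ₗ[𝕜] F) : Set F) := by
    rw [Set.inter_comm]
    exact Subtype.image_preimage_coe _ _
  rwa [← h'']

theorem isClosed_map_of_finiteDimensional_ker [CompleteSpace 𝕜] (A : E →L[𝕜] F)
    (hA : IsClosed (LinearMap.range (A : E →ₗ[𝕜] F) : Set F))
    [FiniteDimensional 𝕜 (LinearMap.ker (A : E →ₗ[𝕜] F))] (W : Submodule 𝕜 E)
    (hW : IsClosed (W : Set E)) : IsClosed (W.map (A : E →ₗ[𝕜] F) : Set F) := by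
  have h := isClosed_inter_range_of_preimage A hA (C := (W.map (A : E →ₗ[𝕜] F) : Set F)) (by
    have h1 := W.isClosed_sup_finiteDimensional (LinearMap.ker (A : E →ₗ[𝕜] F)) hW
    rw [← Submodule.comap_map_eq] at h1
    exact h1)
  rwa [Set.inter_eq_left.mpr] at h
  exact LinearMap.map_le_range

/-- Neubauer's lemma: a range is closed as soon as its sum and its intersection with some closed
subspace are closed. -/
theorem isClosed_range_of_isClosed_sup_inf (f : E →L[𝕜] F) (G : Submodule 𝕜 F)
    (hG : IsClosed (G : Set F))
    (hsup : IsClosed ((LinearMap.range (f : E →ₗ[𝕜] F) ⊔ G : Submodule 𝕜 F) : Set F))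
    (hinf : IsClosed ((LinearMap.range (f : E →ₗ[𝕜] F) ⊓ G : Submodule 𝕜 F) : Set F)) :
    IsClosed (LinearMap.range (f : E →ₗ[𝕜] F) : Set F) := by
  have : CompleteSpace G := hG.completeSpace_coe
  -- Under `(x, g) ↦ f x + g`, the preimage of `R(f)` is the set of pairs with `g ∈ R(f) ∩ G`.
  have hr : LinearMap.range ((f.coprod G.subtypeL : E × G →L[𝕜] F) : E × G →ₗ[𝕜] F) =
      LinearMap.range (f : E →ₗ[𝕜] F) ⊔ G := by
    rw [ContinuousLinearMap.coe_coprod, LinearMap.range_coprod]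
    simp
  have h := isClosed_inter_range_of_preimage (f.coprod G.subtypeL) (by rw [hr]; exact hsup)
    (C := (LinearMap.range (f : E →ₗ[𝕜] F) : Set F)) (by
      have : (f.coprod G.subtypeL) ⁻¹' (LinearMap.range (f : E →ₗ[𝕜] F) : Set F) =
          (fun p : E × G => (p.2 : F)) ⁻¹'
            ((LinearMap.range (f : E →ₗ[𝕜] F) ⊓ G : Submodule 𝕜 F) : Set F) := by
        ext ⟨x, g⟩
        have h1 : (f x + (g : F) ∈ LinearMap.range (f : E →ₗ[𝕜] F)) ↔
            (g : F) ∈ LinearMap.range (f : E →ₗ[𝕜] F) :=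
          Submodule.add_mem_iff_right _ (LinearMap.mem_range_self (f : E →ₗ[𝕜] F) x)
        simpa using h1
      rw [this]
      exact hinf.preimage (by fun_prop))
  rwa [hr, Set.inter_eq_left.mpr] at h
  exact fun x hx => Submodule.mem_sup_left hx

end ClosedRange

/-! ### Stability of semi-Fredholmness under small shifts. -/

section Perturbation

variable {E : Type*} [NormedAddCommGroup E] [NormedSpace ℂ E] [CompleteSpace E]

theorem shift_apply {X : Type*} [NormedAddCommGroup X] [NormedSpace ℂ X] (T : X →L[ℂ] X) (z : ℂ)
    (x : X) : shift T z x = T x - z • x := rfl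

/-- `A` is bounded below on a closed complement `W` of its kernel, and this survives small shifts.
The new kernel then embeds in `E / W ≃ N(A)`, and the new range is a closed space plus a
finite-dimensional one. -/
theorem IsUpperSemiFredholm.exists_shift {A : E →L[ℂ] E} (hA : IsUpperSemiFredholm A) :
    ∃ ε > 0, ∀ z : ℂ, ‖z‖ < ε → IsUpperSemiFredholm (shift A z) := by
  obtain ⟨hk, hr⟩ := hA
  obtain ⟨W, hW, hc⟩ :=
    (Submodule.ClosedComplemented.of_finiteDimensional
      (LinearMap.ker (A : E →ₗ[ℂ] E))).exists_isClosed_isCompl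
  have : CompleteSpace W := hW.completeSpace_coe
  have hinj : Function.Injective (A ∘L W.subtypeL) := by
    rw [injective_iff_map_eq_zero]
    intro x hx
    exact Subtype.ext (Submodule.disjoint_def.mp hc.disjoint x hx x.2)
  have hcl : IsClosed (Set.range (A ∘L W.subtypeL)) := by
    have := isClosed_map_of_finiteDimensional_ker A hr W hW
    convert this using 1
    ext y
    simp
  obtain ⟨K, hK⟩ := (A ∘L W.subtypeL).antilipschitz_of_injective_of_isClosed_range hinj hcl
  -- `K + 1` allows for `K = 0` and gives `1 - K‖z‖ ≥ 1 / (K + 1)`, whence the constant `K (K + 1)`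
  -- below.
  refine ⟨((K : ℝ) + 1)⁻¹, by positivity, fun z hz => ?_⟩
  have hbound : ∀ x : W, ‖x‖ ≤ (K : ℝ) * ‖A x‖ := fun x => by
    simpa using hK.le_mul_norm (x := x)
  have hbound' : ∀ x : W, ‖x‖ ≤ ((K : ℝ) * (K + 1)) * ‖shift A z x‖ := fun x => by
    have h1 : ‖A x‖ ≤ ‖shift A z x‖ + ‖z‖ * ‖x‖ := by
      have : A x = shift A z x + z • (x : E) := by simp [shift_apply]
      rw [this]
      exact (norm_add_le _ _).trans (by rw [norm_smul]; simp)
    have h2 := hbound x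
    have hK0 : (0 : ℝ) ≤ K := K.2
    have h3 : ‖z‖ * ((K : ℝ) + 1) ≤ 1 := by
      have := mul_le_mul_of_nonneg_right hz.le (by positivity : (0 : ℝ) ≤ K + 1)
      rwa [inv_mul_cancel₀ (by positivity)] at this
    have h4 := norm_nonneg x
    have h5 : ‖x‖ * (K + 1) ≤ (K : ℝ) * (K + 1) * ‖shift A z x‖ + K * ‖x‖ := by
      have h6 : ‖x‖ ≤ K * (‖shift A z x‖ + ‖z‖ * ‖x‖) :=
        h2.trans (mul_le_mul_of_nonneg_left h1 hK0)
      have h7 := mul_le_mul_of_nonneg_right h6 (by positivity : (0 : ℝ) ≤ K + 1)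
      have h8 := mul_le_mul_of_nonneg_left h3 (mul_nonneg hK0 h4)
      linarith
    linarith
  have hanti : AntilipschitzWith (K * (K + 1)) (shift A z ∘L W.subtypeL) :=
    (shift A z ∘L W.subtypeL).antilipschitz_of_bound (by simpa using hbound')
  have hdisj : Disjoint (LinearMap.ker (shift A z : E →ₗ[ℂ] E)) W := by
    rw [Submodule.disjoint_def]
    intro x hx hxW
    have := hbound' ⟨x, hxW⟩
    have hx0 : shift A z x = 0 := hx
    simpa [hx0] using this
  constructor
  · let e := Submodule.quotientEquivOfIsCompl W _ hc.symm
    let j : LinearMap.ker (shift A z : E →ₗ[ℂ] E) →ₗ[ℂ] LinearMap.ker (A : E →ₗ[ℂ] E) :=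
      e.toLinearMap ∘ₗ W.mkQ ∘ₗ Submodule.subtype _
    refine FiniteDimensional.of_injective j ?_
    rw [injective_iff_map_eq_zero]
    intro x hx
    have hx' : W.mkQ (x : E) = 0 := e.map_eq_zero_iff.mp hx
    exact Subtype.ext (Submodule.disjoint_def.mp hdisj x x.2 (by simpa using hx'))
  · have h1 : IsClosed (W.map (shift A z : E →ₗ[ℂ] E) : Set E) := by
      have := hanti.isClosed_range (shift A z ∘L W.subtypeL).uniformContinuous
      convert this using 1
      ext y
      simp
    have h2 := Submodule.isClosed_sup_finiteDimensional _
      ((LinearMap.ker (A : E →ₗ[ℂ] E)).map (shift A z : E →ₗ[ℂ] E)) h1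
    rwa [← Submodule.map_sup, hc.symm.sup_eq_top, Submodule.map_top] at h2

end Perturbation

/-! ### Nonzero shifts and restriction to `R(S^n)`. -/

section Shift

variable {X : Type*} [NormedAddCommGroup X] [NormedSpace ℂ X]

theorem shift_eq (S : X →L[ℂ] X) (z : ℂ) : shift S z = S - algebraMap ℂ (X →L[ℂ] X) z := by
  ext x
  simp [shift_apply]

theorem exists_pow_shift_bezout (S : X →L[ℂ] X) {z : ℂ} (hz : z ≠ 0) (n : ℕ) :
    ∃ p q : X →L[ℂ] X, Commute p S ∧ Commute q S ∧ p * shift S z + q * S ^ n = 1 := by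
  have hc : IsCoprime (Polynomial.X - Polynomial.C z) (Polynomial.X : Polynomial ℂ) := by
    refine ⟨-Polynomial.C z⁻¹, Polynomial.C z⁻¹, ?_⟩
    rw [mul_sub, neg_mul, neg_mul, ← Polynomial.C_mul, inv_mul_cancel₀ hz]
    simp
  obtain ⟨a, b, hab⟩ := hc.pow_right (n := n)
  refine ⟨Polynomial.aeval S a, Polynomial.aeval S b, ?_, ?_, ?_⟩
  · have := (Commute.all a Polynomial.X).map (Polynomial.aeval S)
    rwa [Polynomial.aeval_X] at this
  · have := (Commute.all b Polynomial.X).map (Polynomial.aeval S)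
    rwa [Polynomial.aeval_X] at this
  · simpa [shift_eq] using congrArg (Polynomial.aeval S) hab

theorem commute_shift {p S : X →L[ℂ] X} (h : Commute p S) (z : ℂ) : Commute p (shift S z) := by
  rw [shift_eq]
  exact h.sub_right (Algebra.commutes z p).symm

/-- Upper semi-Fredholmness of `S - z I`, `z ≠ 0`, may be tested on `R(S^n)`. -/
theorem IsUpperSemiFredholm.shift_of_powRestrict {S : X →L[ℂ] X} {n : ℕ} {z : ℂ} (hz : z ≠ 0)
    (hn : IsClosed (powRange S n : Set X))
    (h : IsUpperSemiFredholm (shift (powRestrict S n) z)) : IsUpperSemiFredholm (shift S z) := by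
  obtain ⟨p, q, hp, hq, hpq⟩ := exists_pow_shift_bezout S hz n
  have hqn : Commute q (S ^ n) := hq.pow_right n
  have hpn : Commute p (S ^ n) := hp.pow_right n
  have hsn : Commute (shift S z) (S ^ n) :=
    ((commute_shift (Commute.refl S) z).symm).pow_right n
  have hdec : ∀ x, p (shift S z x) + (S ^ n) (q x) = x := fun x => by
    have := congrArg (fun f : X →L[ℂ] X => f x) (hqn.eq ▸ hpq)
    exact this
  have hps : ∀ x, p (shift S z x) = shift S z (p x) := fun x =>
    congrArg (fun f : X →L[ℂ] X => f x) (commute_shift hp z).eq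
  have hpS : ∀ x, p ((S ^ n) x) = (S ^ n) (p x) := fun x =>
    congrArg (fun f : X →L[ℂ] X => f x) hpn.eq
  have hss : ∀ x, (S ^ n) (shift S z x) = shift S z ((S ^ n) x) := fun x =>
    congrArg (fun f : X →L[ℂ] X => f x) hsn.eq.symm
  obtain ⟨hk, hr⟩ := h
  have hker : ∀ x, shift S z x = 0 → x ∈ powRange S n := fun x hx =>
    ⟨q x, by have := hdec x; rwa [hx, map_zero, zero_add] at this⟩
  constructor
  · let j : LinearMap.ker (shift S z : X →ₗ[ℂ] X) →ₗ[ℂ]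
        LinearMap.ker (shift (powRestrict S n) z : powRange S n →ₗ[ℂ] powRange S n) :=
      LinearMap.codRestrict _ (LinearMap.codRestrict _ (Submodule.subtype _)
        fun x => hker x x.2) fun x => Subtype.ext x.2
    refine FiniteDimensional.of_injective j fun x y hxy => ?_
    have h1 : ((j x : powRange S n) : X) = (j y : powRange S n) := by rw [hxy]
    exact Subtype.ext h1
  · have hcl : IsClosed (((↑) : powRange S n → X) ''
        (LinearMap.range (shift (powRestrict S n) z : powRange S n →ₗ[ℂ] powRange S n) :
          Set (powRange S n))) := hn.isClosedEmbedding_subtypeVal.isClosedMap _ hr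
    -- `R(S - z)` is the preimage under `S^n` of the range of the restricted shift.
    convert hcl.preimage (S ^ n).continuous using 1
    ext y
    constructor
    · rintro ⟨x, rfl⟩
      exact ⟨_, ⟨⟨(S ^ n) x, x, rfl⟩, rfl⟩, (hss x).symm⟩
    · rintro ⟨_, ⟨w, rfl⟩, hw⟩
      have hw' : shift S z w = (S ^ n) y := hw
      -- Substitute `S^n y = (S - z) w` into `y = p (S - z) y + q S^n y`.
      refine ⟨p y + q w, ?_⟩
      have hqs : shift S z (q w) = q (shift S z w) :=
        congrArg (fun f : X →L[ℂ] X => f w) (commute_shift hq z).eq.symm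
      have hqS : q ((S ^ n) y) = (S ^ n) (q y) := congrArg (fun f : X →L[ℂ] X => f y) hqn.eq
      change shift S z (p y + q w) = y
      rw [map_add, hqs, hw', hqS, ← hps, hdec]

end Shift

/-! ### Ranges of powers, ascent and closedness. -/

section PowRange

variable {X : Type*} [NormedAddCommGroup X] [NormedSpace ℂ X]

theorem pow_succ_apply (S : X →L[ℂ] X) (n : ℕ) (x : X) : (S ^ (n + 1)) x = S ((S ^ n) x) :=
  congrArg (fun f : X →L[ℂ] X => f x) (pow_succ' S n)

theorem powRange_zero (S : X →L[ℂ] X) : powRange S 0 = ⊤ :=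
  LinearMap.range_eq_top.mpr fun x => ⟨x, rfl⟩

theorem powRange_succ (S : X →L[ℂ] X) (n : ℕ) :
    powRange S (n + 1) = (powRange S n).map (S : X →ₗ[ℂ] X) := by
  ext y
  constructor
  · rintro ⟨x, rfl⟩
    exact ⟨(S ^ n) x, ⟨x, rfl⟩, (pow_succ_apply S n x).symm⟩
  · rintro ⟨_, ⟨x, rfl⟩, rfl⟩
    exact ⟨x, pow_succ_apply S n x⟩

theorem powRange_antitone (S : X →L[ℂ] X) : Antitone (powRange S) :=
  antitone_nat_of_succ_le fun n => by
    rw [powRange_succ]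
    rintro _ ⟨x, hx, rfl⟩
    exact map_mem_powRange S n hx

theorem comap_powRange_succ (S : X →L[ℂ] X) (n : ℕ) :
    (powRange S (n + 1)).comap (S : X →ₗ[ℂ] X) =
      powRange S n ⊔ LinearMap.ker (S : X →ₗ[ℂ] X) := by
  rw [powRange_succ, Submodule.comap_map_eq]

theorem coe_range_powRestrict (S : X →L[ℂ] X) (n : ℕ) :
    (LinearMap.range (powRestrict S n : powRange S n →ₗ[ℂ] powRange S n) : Set (powRange S n)) =
      (↑) ⁻¹' (powRange S (n + 1) : Set X) := by
  rw [powRange_succ]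
  ext y
  constructor
  · rintro ⟨x, rfl⟩
    exact ⟨x, x.2, rfl⟩
  · rintro ⟨x, hx, hxy⟩
    exact ⟨⟨x, hx⟩, Subtype.ext hxy⟩

theorem IsUpperSemiFredholm.isUpperSemiBFredholm {S : X →L[ℂ] X} (hS : IsUpperSemiFredholm S) :
    IsUpperSemiBFredholm S := by
  obtain ⟨hk, hr⟩ := hS
  refine ⟨0, by rw [powRange_zero]; exact isClosed_univ, ?_, ?_⟩
  · let j : LinearMap.ker (powRestrict S 0 : powRange S 0 →ₗ[ℂ] powRange S 0) →ₗ[ℂ]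
        LinearMap.ker (S : X →ₗ[ℂ] X) :=
      LinearMap.codRestrict _ (Submodule.subtype _ ∘ₗ Submodule.subtype _)
        fun x => congrArg Subtype.val x.2
    refine FiniteDimensional.of_injective j fun x y hxy => ?_
    have h1 : (j x : X) = j y := by rw [hxy]
    exact Subtype.ext (Subtype.ext h1)
  · rw [coe_range_powRestrict]
    refine IsClosed.preimage continuous_subtype_val ?_
    rwa [powRange, zero_add, pow_one]

theorem ker_pow_eq_of_disjoint {S : X →L[ℂ] X} {p : ℕ}
    (h : powRange S p ⊓ LinearMap.ker (S : X →ₗ[ℂ] X) = ⊥) :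
    LinearMap.ker ((S ^ p : X →L[ℂ] X) : X →ₗ[ℂ] X) =
      LinearMap.ker ((S ^ (p + 1) : X →L[ℂ] X) : X →ₗ[ℂ] X) := by
  ext x
  have hs : (S ^ (p + 1)) x = S ((S ^ p) x) := pow_succ_apply S p x
  change (S ^ p) x = 0 ↔ (S ^ (p + 1)) x = 0
  rw [hs]
  constructor
  · intro hx
    rw [hx, map_zero]
  · intro hx
    have : (S ^ p) x ∈ powRange S p ⊓ LinearMap.ker (S : X →ₗ[ℂ] X) := ⟨⟨x, rfl⟩, hx⟩
    rwa [h, Submodule.mem_bot] at this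

theorem HasAscent.disjoint {S : X →L[ℂ] X} {p : ℕ} (h : HasAscent S p) :
    powRange S p ⊓ LinearMap.ker (S : X →ₗ[ℂ] X) = ⊥ := by
  rw [eq_bot_iff]
  rintro _ ⟨⟨y, rfl⟩, hx⟩
  have hy : y ∈ LinearMap.ker ((S ^ (p + 1) : X →L[ℂ] X) : X →ₗ[ℂ] X) :=
    (pow_succ_apply S p y).trans hx
  have h1 : LinearMap.ker ((S ^ p : X →L[ℂ] X) : X →ₗ[ℂ] X) =
    LinearMap.ker ((S ^ (p + 1) : X →L[ℂ] X) : X →ₗ[ℂ] X) := h.1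
  rw [← h1] at hy
  exact hy

theorem exists_hasAscent {S : X →L[ℂ] X} {p : ℕ}
    (h : powRange S p ⊓ LinearMap.ker (S : X →ₗ[ℂ] X) = ⊥) : ∃ q ≤ p, HasAscent S q := by
  classical
  have hex : ∃ n, LinearMap.ker ((S ^ n : X →L[ℂ] X) : X →ₗ[ℂ] X) =
    LinearMap.ker ((S ^ (n + 1) : X →L[ℂ] X) : X →ₗ[ℂ] X) := ⟨p, ker_pow_eq_of_disjoint h⟩
  exact ⟨Nat.find hex, Nat.find_min' hex (ker_pow_eq_of_disjoint h),
    Nat.find_spec hex, fun m hm => Nat.find_min' hex hm⟩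

theorem finiteDimensional_powRange_inf_ker_of_le {S : X →L[ℂ] X} {m n : ℕ} (hmn : m ≤ n)
    [FiniteDimensional ℂ ↥(powRange S m ⊓ LinearMap.ker (S : X →ₗ[ℂ] X))] :
    FiniteDimensional ℂ ↥(powRange S n ⊓ LinearMap.ker (S : X →ₗ[ℂ] X)) :=
  Submodule.finiteDimensional_of_le (inf_le_inf_right _ (powRange_antitone S hmn))

theorem finiteDimensional_powRange_inf_ker {S : X →L[ℂ] X} {n : ℕ}
    (h : IsUpperSemiFredholm (powRestrict S n)) :
    FiniteDimensional ℂ ↥(powRange S n ⊓ LinearMap.ker (S : X →ₗ[ℂ] X)) := by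
  have := h.1
  let j : ↥(powRange S n ⊓ LinearMap.ker (S : X →ₗ[ℂ] X)) →ₗ[ℂ]
      LinearMap.ker (powRestrict S n : powRange S n →ₗ[ℂ] powRange S n) :=
    LinearMap.codRestrict _ (LinearMap.codRestrict _ (Submodule.subtype _)
      fun x => x.2.1) fun x => Subtype.ext x.2.2
  refine FiniteDimensional.of_injective j fun x y hxy => ?_
  have h1 : ((j x : powRange S n) : X) = (j y : powRange S n) := by rw [hxy]
  exact Subtype.ext h1

variable [CompleteSpace X]

/-- Downward induction by Neubauer's lemma with `G = N(S)`: the sum `R(S^k) + N(S)` is the preimage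
of `R(S^(k+1))` under `S`, and the intersection is finite-dimensional. -/
theorem isClosed_powRange_of_le {S : X →L[ℂ] X} {m n : ℕ} (hmn : m ≤ n)
    [hfd : FiniteDimensional ℂ ↥(powRange S m ⊓ LinearMap.ker (S : X →ₗ[ℂ] X))]
    (hn : IsClosed (powRange S n : Set X)) : IsClosed (powRange S m : Set X) := by
  induction n, hmn using Nat.le_induction with
  | base => exact hn
  | succ k hk ih =>
    refine ih ?_
    have := finiteDimensional_powRange_inf_ker_of_le (S := S) hk
    refine isClosed_range_of_isClosed_sup_inf (S ^ k) (LinearMap.ker (S : X →ₗ[ℂ] X))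
      S.isClosed_ker ?_ (Submodule.closed_of_finiteDimensional (powRange S k ⊓ _))
    have h := hn.preimage S.continuous
    have h' : S ⁻¹' (powRange S (k + 1) : Set X) =
      ((powRange S k ⊔ LinearMap.ker (S : X →ₗ[ℂ] X) : Submodule ℂ X) : Set X) := by
      rw [← comap_powRange_succ]
      rfl
    rwa [h'] at h

/-- An upper semi-Fredholm operator maps closed subspaces to closed subspaces; apply this to `S` on
`R(S^n)` repeatedly. -/
theorem isClosed_powRange_of_ge {S : X →L[ℂ] X} {n : ℕ} (hn : IsClosed (powRange S n : Set X))
    (h : IsUpperSemiFredholm (powRestrict S n)) {k : ℕ} (hk : n ≤ k) :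
    IsClosed (powRange S k : Set X) := by
  have : CompleteSpace (powRange S n) := hn.completeSpace_coe
  obtain ⟨hker, hr⟩ := h
  induction k, hk using Nat.le_induction with
  | base => exact hn
  | succ k hk ih =>
    have h1 := isClosed_map_of_finiteDimensional_ker (powRestrict S n) hr
      ((powRange S k).comap (powRange S n).subtype) (ih.preimage continuous_subtype_val)
    have h2 := hn.isClosedEmbedding_subtypeVal.isClosedMap _ h1
    convert h2 using 1
    rw [powRange_succ]
    ext y
    constructor
    · rintro ⟨x, hx, rfl⟩
      exact ⟨powRestrict S n ⟨x, powRange_antitone S hk hx⟩, ⟨_, hx, rfl⟩, rfl⟩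
    · rintro ⟨_, ⟨x, hx, rfl⟩, rfl⟩
      exact ⟨x, hx, rfl⟩

theorem IsLeftDrazinInvertible.isUpperSemiBFredholm {S : X →L[ℂ] X}
    (h : IsLeftDrazinInvertible S) : IsUpperSemiBFredholm S := by
  obtain ⟨p, hp, hcl⟩ := h
  have hd := hp.disjoint
  have : FiniteDimensional ℂ ↥(powRange S p ⊓ LinearMap.ker (S : X →ₗ[ℂ] X)) := by
    rw [hd]; infer_instance
  refine ⟨p, isClosed_powRange_of_le p.le_succ hcl, ?_, ?_⟩
  · have hk : LinearMap.ker (powRestrict S p : powRange S p →ₗ[ℂ] powRange S p) = ⊥ := by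
      rw [eq_bot_iff]
      intro x hx
      have h1 : (x : X) ∈ powRange S p ⊓ LinearMap.ker (S : X →ₗ[ℂ] X) :=
        ⟨x.2, congrArg Subtype.val hx⟩
      rw [hd, Submodule.mem_bot] at h1
      exact Subtype.ext h1
    rw [hk]
    infer_instance
  · rw [coe_range_powRestrict]
    exact hcl.preimage continuous_subtype_val

theorem IsUpperSemiBFredholm.isUpperSemiFredholm {S : X →L[ℂ] X} (h : IsUpperSemiBFredholm S)
    [hk : FiniteDimensional ℂ (LinearMap.ker (S : X →ₗ[ℂ] X))] : IsUpperSemiFredholm S := by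
  obtain ⟨n, hn, hS⟩ := h
  refine ⟨hk, ?_⟩
  have : FiniteDimensional ℂ ↥(powRange S 1 ⊓ LinearMap.ker (S : X →ₗ[ℂ] X)) :=
    Submodule.finiteDimensional_inf_right _ _
  -- Descend from `n + 1`, not `n`, so that exponent `1` is reached even when `n = 0`.
  have h1 := isClosed_powRange_of_le (S := S) (m := 1) (n := n + 1) (by lia)
    (isClosed_powRange_of_ge hn hS n.le_succ)
  rwa [powRange, pow_one] at h1

end PowRange

/-- A surjective operator with nontrivial kernel keeps a nontrivial kernel under small shifts. -/
theorem exists_shift_ker_ne_bot {M : Type*} [NormedAddCommGroup M] [NormedSpace ℂ M]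
    [CompleteSpace M] (A : M →L[ℂ] M) (hA : Function.Surjective A) {x : M} (hx : A x = 0)
    (hx0 : x ≠ 0) : ∃ ε > 0, ∀ z : ℂ, ‖z‖ < ε → ∃ v ≠ 0, shift A z v = 0 := by
  obtain ⟨C, hC, hpre⟩ := A.exists_preimage_norm_le hA
  choose g hg hgC using hpre
  -- The ratio `1/3` bounds the tail of the series below by `‖x‖ / 2`, so it cannot cancel its first
  -- term `x`.
  refine ⟨(3 * C)⁻¹, by positivity, fun z hz => ?_⟩
  have hzC : ‖z‖ * C ≤ 1 / 3 := by
    have := mul_le_mul_of_nonneg_right hz.le hC.le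
    rwa [mul_inv, mul_assoc, inv_mul_cancel₀ hC.ne', mul_one, ← one_div] at this
  -- Formal eigenvector `∑ z^k g^k x`, with `g` a bounded, possibly nonlinear, right inverse of `A`.
  set u : ℕ → M := fun k => z ^ k • g^[k] x with hu
  have hu0 : u 0 = x := by simp [hu]
  have hus : ∀ k, A (u (k + 1)) = z • u k := fun k => by
    simp only [hu, Function.iterate_succ_apply', map_smul, hg, pow_succ', mul_smul]
  have hnorm : ∀ k, ‖u k‖ ≤ ‖x‖ * (1 / 3) ^ k := fun k => by
    induction k with
    | zero => simp [hu0]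
    | succ k ih =>
      have h1 : ‖u (k + 1)‖ ≤ ‖z‖ * C * ‖u k‖ := by
        simp only [hu, Function.iterate_succ_apply', norm_smul, norm_mul, norm_pow, pow_succ']
        have := mul_le_mul_of_nonneg_left (hgC (g^[k] x)) (by positivity : 0 ≤ ‖z‖ * ‖z‖ ^ k)
        linarith
      have h2 := mul_le_mul hzC ih (norm_nonneg _) (by norm_num)
      rw [pow_succ]
      linarith
  have hgeo : HasSum (fun k : ℕ => (1 / 3 : ℝ) ^ k) (1 - 1 / 3)⁻¹ :=
    hasSum_geometric_of_lt_one (by norm_num) (by norm_num)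
  have hsum : Summable u := Summable.of_norm_bounded (hgeo.summable.mul_left _) hnorm
  refine ⟨∑' k, u k, fun h0 => ?_, ?_⟩
  · rw [hsum.tsum_eq_zero_add, hu0] at h0
    have h1 : ‖∑' k, u (k + 1)‖ ≤ ‖x‖ * (1 / 3) * (1 - 1 / 3)⁻¹ :=
      tsum_of_norm_bounded (hgeo.mul_left _) fun k =>
        (hnorm (k + 1)).trans_eq (by rw [pow_succ']; ring)
    rw [← neg_eq_of_add_eq_zero_right h0, norm_neg] at h1
    have h2 := norm_pos_iff.mpr hx0
    norm_num at h1
    linarith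
  · rw [shift_apply, A.map_tsum hsum, (A.summable hsum).tsum_eq_zero_add, hu0, hx, zero_add,
      tsum_congr hus, tsum_const_smul'', sub_self]

/-! ### Behaviour near a semi-B-Fredholm point. -/

section PuncturedNeighbourhood

variable {X : Type*} [NormedAddCommGroup X] [NormedSpace ℂ X]

theorem exists_stable_powRange_inf_ker (S : X →L[ℂ] X) (n : ℕ)
    [FiniteDimensional ℂ ↥(powRange S n ⊓ LinearMap.ker (S : X →ₗ[ℂ] X))] :
    ∃ d ≥ n, ∀ k ≥ d, powRange S k ⊓ LinearMap.ker (S : X →ₗ[ℂ] X) =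
      powRange S d ⊓ LinearMap.ker (S : X →ₗ[ℂ] X) := by
  let V : ℕ → Submodule ℂ X := fun k => powRange S k ⊓ LinearMap.ker (S : X →ₗ[ℂ] X)
  let r : ℕ → ℕ := fun k => Module.finrank ℂ (V (n + k))
  obtain ⟨m, hm⟩ : ∃ m, ∀ k, r m ≤ r k :=
    ⟨Function.argmin r, fun k => Function.argmin_le r k⟩
  refine ⟨n + m, by lia, fun k hk => ?_⟩
  have : FiniteDimensional ℂ (V (n + m)) :=
    finiteDimensional_powRange_inf_ker_of_le (m := n) (by lia)
  refine Submodule.eq_of_le_of_finrank_le (inf_le_inf_right _ (powRange_antitone S hk)) ?_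
  have := hm (k - n)
  simp only [r] at this
  rwa [show n + (k - n) = k by lia] at this

theorem shift_shift (T : X →L[ℂ] X) (z w : ℂ) : shift (shift T z) w = shift T (z + w) := by
  ext x
  simp only [shift_apply, add_smul]
  abel

theorem IsBoundedBelow.injective {S : X →L[ℂ] X} (h : IsBoundedBelow S) :
    Function.Injective S := by
  obtain ⟨c, hc, h⟩ := h
  rw [injective_iff_map_eq_zero]
  intro x hx
  have := h x
  rw [hx, norm_zero] at this
  exact norm_le_zero_iff.mp (nonpos_of_mul_nonpos_right this hc)

theorem ker_shift (T : X →L[ℂ] X) (z : ℂ) :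
    LinearMap.ker (shift T z : X →ₗ[ℂ] X) = Module.End.eigenspace (T : Module.End ℂ X) z := by
  ext x
  rw [Module.End.mem_eigenspace_iff, ← sub_eq_zero]
  rfl

theorem mem_pi00_iff {T : X →L[ℂ] X} {z : ℂ} :
    z ∈ pi00 T ↔ z ∈ pi0 T ∧ FiniteDimensional ℂ (LinearMap.ker (shift T z : X →ₗ[ℂ] X)) := by
  rw [ker_shift]
  exact and_assoc.symm

theorem deltaUf_subset_deltaUfG (T : X →L[ℂ] X) : deltaUf T ⊆ deltaUfG T := fun _ hz =>
  ⟨hz.1, fun hn => hn (not_not.mp hz.2).isUpperSemiBFredholm⟩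

variable [CompleteSpace X]

/-- The spaces `R(S^k) ∩ N(S)` stabilize. If the limit is zero, the ascent is finite. Otherwise it
lies in `M = ⋂ R(S^k)`, which `S` maps onto itself with nonzero kernel, so no small shift is
injective. -/
theorem IsUpperSemiBFredholm.exists_isLeftDrazinInvertible {S : X →L[ℂ] X}
    (h : IsUpperSemiBFredholm S) :
    ∃ ε > 0, ∀ z : ℂ, ‖z‖ < ε → Function.Injective (shift S z) → IsLeftDrazinInvertible S := by
  obtain ⟨n, hn, hS⟩ := h
  have hcl : ∀ k ≥ n, IsClosed (powRange S k : Set X) := fun k hk =>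
    isClosed_powRange_of_ge hn hS hk
  have hfd := finiteDimensional_powRange_inf_ker hS
  obtain ⟨d, hnd, hd⟩ := exists_stable_powRange_inf_ker S n
  by_cases hbot : powRange S d ⊓ LinearMap.ker (S : X →ₗ[ℂ] X) = ⊥
  · refine ⟨1, one_pos, fun z _ _ => ?_⟩
    obtain ⟨p, hpd, hp⟩ := exists_hasAscent hbot
    have : FiniteDimensional ℂ ↥(powRange S p ⊓ LinearMap.ker (S : X →ₗ[ℂ] X)) := by
      rw [hp.disjoint]; infer_instance
    have := finiteDimensional_powRange_inf_ker_of_le (S := S) p.le_succ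
    exact ⟨p, hp, isClosed_powRange_of_le (n := d + 1) (by lia) (hcl _ (by lia))⟩
  obtain ⟨x, ⟨hxd, hxk⟩, hx0⟩ := Submodule.exists_mem_ne_zero_of_ne_bot hbot
  let M : Submodule ℂ X := ⨅ k, powRange S (d + k)
  have hmem : ∀ y, y ∈ M ↔ ∀ k, y ∈ powRange S (d + k) := fun y => Submodule.mem_iInf _
  have hM : IsClosed (M : Set X) := by
    rw [Submodule.coe_iInf]
    exact isClosed_iInter fun k => hcl _ (by lia)
  have hinv : ∀ y ∈ M, S y ∈ M := fun y hy => (hmem _).mpr fun k =>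
    map_mem_powRange S _ ((hmem y).mp hy k)
  have hker : ∀ y, y ∈ powRange S d → S y = 0 → y ∈ M := fun y hy hy0 => (hmem _).mpr fun k => by
    have : y ∈ powRange S d ⊓ LinearMap.ker (S : X →ₗ[ℂ] X) := ⟨hy, hy0⟩
    rw [← hd (d + k) (by lia)] at this
    exact this.1
  have hsurj : ∀ y ∈ M, ∃ w ∈ M, S w = y := fun y hy => by
    have hex : ∀ k, ∃ w ∈ powRange S (d + k), S w = y := fun k => by
      have h1 := (hmem y).mp hy (k + 1)
      rw [← add_assoc, powRange_succ] at h1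
      exact h1
    obtain ⟨w, hw, hwy⟩ := hex 0
    -- Two preimages of `y` in `R(S^d)` differ by an element of `R(S^d) ∩ N(S) ⊆ M`, so one `w`
    -- serves every `k`.
    refine ⟨w, (hmem w).mpr fun k => ?_, hwy⟩
    obtain ⟨v, hv, hvy⟩ := hex k
    have h1 : w - v ∈ M := hker _
      (sub_mem hw (powRange_antitone S (by lia) hv)) (by rw [map_sub, hwy, hvy, sub_self])
    have h2 := add_mem ((hmem _).mp h1 k) hv
    rwa [sub_add_cancel] at h2
  have : CompleteSpace M := hM.completeSpace_coe
  obtain ⟨ε, hε, hz⟩ := exists_shift_ker_ne_bot (S.restrict hinv : M →L[ℂ] M)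
    (fun y => by
      obtain ⟨w, hw, hwy⟩ := hsurj y y.2
      exact ⟨⟨w, hw⟩, Subtype.ext hwy⟩)
    (x := ⟨x, hker x hxd hxk⟩) (Subtype.ext hxk) (fun h0 => hx0 (congrArg Subtype.val h0))
  refine ⟨ε, hε, fun z hzε hinj => ?_⟩
  obtain ⟨v, hv0, hv⟩ := hz z hzε
  have h1 : shift S z v = 0 := congrArg Subtype.val hv
  exact (hv0 (Subtype.ext (hinj (h1.trans (map_zero _).symm)))).elim

theorem IsUpperSemiBFredholm.exists_shift_isUpperSemiFredholm {S : X →L[ℂ] X}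
    (h : IsUpperSemiBFredholm S) :
    ∃ ε > 0, ∀ z : ℂ, z ≠ 0 → ‖z‖ < ε → IsUpperSemiFredholm (shift S z) := by
  obtain ⟨n, hn, hS⟩ := h
  have : CompleteSpace (powRange S n) := hn.completeSpace_coe
  obtain ⟨ε, hε, hz⟩ := hS.exists_shift
  exact ⟨ε, hε, fun z hz0 hzε => .shift_of_powRestrict hz0 hn (hz z hzε)⟩

theorem injective_shift_of_notMem_spectrum {T : X →L[ℂ] X} {z : ℂ} (h : z ∉ spectrum ℂ T) :
    Function.Injective (shift T z) := by
  rw [spectrum.notMem_iff] at h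
  have h1 : IsUnit (shift T z) := by
    rw [shift_eq, ← neg_sub]
    exact h.neg
  exact (ContinuousLinearMap.isUnit_iff_bijective.mp h1).1

theorem exists_injective_shift_of_mem_iso {T : X →L[ℂ] X} {z : ℂ}
    (h : z ∈ iso (spectrum ℂ T)) {ε : ℝ} (hε : 0 < ε) :
    ∃ w : ℂ, ‖w‖ < ε ∧ Function.Injective (shift T (z + w)) := by
  by_contra! hcon
  refine h.2 (accPt_iff_nhds.mpr fun U hU => ?_)
  obtain ⟨δ, hδ, hδU⟩ := Metric.mem_nhds_iff.mp hU
  have hpos : 0 < min ε δ / 2 := by positivity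
  obtain ⟨w, hn⟩ := exists_norm_eq ℂ hpos.le
  have h1 := min_le_left ε δ
  have h2 := min_le_right ε δ
  refine ⟨z + w, ⟨hδU ?_, ?_⟩, ?_⟩
  · rw [Metric.mem_ball, dist_self_add_left, hn]
    linarith
  · by_contra hs
    exact hcon _ (by rw [hn]; linarith) (injective_shift_of_notMem_spectrum hs)
  · intro h0
    rw [add_eq_left] at h0
    rw [h0, norm_zero] at hn
    exact hpos.ne hn

theorem leftPoles_subset_deltaUfG (T : X →L[ℂ] X) : leftPoles T ⊆ deltaUfG T := fun _ hz =>
  ⟨hz.1, fun hn => hn (not_not.mp hz.2).isUpperSemiBFredholm⟩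

theorem mem_leftPoles_of_mem_iso {T : X →L[ℂ] X} {z : ℂ} (hz : z ∈ deltaUfG T)
    (hi : z ∈ iso (spectrum ℂ T)) : z ∈ leftPoles T := by
  obtain ⟨ε, hε, h⟩ := (not_not.mp hz.2 : IsUpperSemiBFredholm _).exists_isLeftDrazinInvertible
  obtain ⟨w, hw, hinj⟩ := exists_injective_shift_of_mem_iso hi hε
  exact ⟨hz.1, fun hn => hn (h w hw (by rwa [shift_shift]))⟩

theorem mem_leftPoles_of_propertyWPi00 {T : X →L[ℂ] X} (hT : PropertyWPi00 T) {z : ℂ}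
    (hz : z ∈ deltaUfG T) : z ∈ leftPoles T := by
  have hB : IsUpperSemiBFredholm (shift T z) := not_not.mp hz.2
  obtain ⟨ε, hε, h⟩ := hB.exists_isLeftDrazinInvertible
  obtain ⟨δ, hδ, h'⟩ := hB.exists_shift_isUpperSemiFredholm
  -- Half the radius leaves room for a second displacement `v`.
  have hpos : 0 < min ε δ / 2 := by positivity
  have h1 := min_le_left ε δ
  have h2 := min_le_right ε δ
  obtain ⟨w, hn⟩ := exists_norm_eq ℂ hpos.le
  have huf := h' w (norm_pos_iff.mp (by rw [hn]; exact hpos)) (by linarith)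
  rw [shift_shift] at huf
  refine ⟨hz.1, fun hld => hld ?_⟩
  by_cases hinj : Function.Injective (shift T (z + w))
  · exact h w (by linarith) (by rwa [shift_shift])
  have hmem : z + w ∈ deltaUf T := ⟨fun hb => hinj hb.injective, fun hu => hu huf⟩
  rw [show deltaUf T = pi00 T from hT] at hmem
  obtain ⟨v, hv, hvinj⟩ := exists_injective_shift_of_mem_iso hmem.1 hpos
  refine h (w + v) ((norm_add_le _ _).trans_lt (by linarith)) ?_
  rwa [shift_shift, ← add_assoc]

end PuncturedNeighbourhood

end WeylType

theorem mainTheorem2 {X : Type*} [NormedAddCommGroup X] [NormedSpace ℂ X] [CompleteSpace X]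
    (T : X →L[ℂ] X) :
    WeylType.PropertyGWPi00 T ↔
      WeylType.PropertyWPi00 T ∧ WeylType.pi0 T = WeylType.leftPoles T := by
  constructor
  · intro h
    have h' : WeylType.deltaUfG T = WeylType.pi0 T := h
    refine ⟨Set.Subset.antisymm (fun z hz => ?_) (fun z hz => ?_),
      Set.Subset.antisymm (fun z hz => ?_) (fun z hz => ?_)⟩
    · exact WeylType.mem_pi00_iff.mpr
        ⟨h' ▸ WeylType.deltaUf_subset_deltaUfG T hz, (not_not.mp hz.2).1⟩
    · obtain ⟨hz0, hfd⟩ := WeylType.mem_pi00_iff.mp hz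
      rw [← h'] at hz0
      exact ⟨hz0.1, fun hn =>
        hn (not_not.mp hz0.2 : WeylType.IsUpperSemiBFredholm _).isUpperSemiFredholm⟩
    · exact WeylType.mem_leftPoles_of_mem_iso (h' ▸ hz) hz.1
    · exact h' ▸ WeylType.leftPoles_subset_deltaUfG T hz
  · rintro ⟨hw, hp⟩
    refine Set.Subset.antisymm (fun z hz => ?_) (fun z hz => ?_)
    · rw [hp]
      exact WeylType.mem_leftPoles_of_propertyWPi00 hw hz
    · rw [hp] at hz
      exact WeylType.leftPoles_subset_deltaUfG T hz
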